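/- Let $\Omega\subset\mathbb R^2$ be a bounded open set with $\Omega=\operatorname{int}\overline\Omega$ (for instance a bounded Lipschitz domain). Let $A:\overline\Omega\to\mathbb C$ and $\phi:\overline\Omega\to\mathbb R$ be of class $C^2$ up to the boundary and independent of $\omega$, let $c:\overline\Omega\to(0,\infty)$, and suppose the eikonal equation $|\nabla\phi|=1/c$ holds on $\overline\Omega$. For $\omega>0$ let $u=u_\omega\in L^2(\Omega)$ satisfy the single-front geometric optics ansatz $\|u-Ae^{i\omega\phi}\|_{L^2(\Omega)}\le C_0\,\omega^{-1}$. Let $\mathcal T_h$ be a conforming triangulation of $\overline\Omega$ with all triangles of diameter at most $h>0$. Let $\widehat{\mathbf d}_j=\nabla\phi(\mathbf x_j)/|\nabla\phi(\mathbf x_j)|$ be the exact ray direction at the node $\mathbf x_j$, and let $\widehat{\mathbf d}{}_j^h\in\mathbb R^2$ be estimated directions with $|\widehat{\mathbf d}_j-\widehat{\mathbf d}{}_j^h|\le C_1\,\omega^{-1/2}$ for all nodes. With $k_j=\omega/c(\mathbf x_j)$ and $\varphi_j$ the nodal $\mathbb P_1$ basis functions, put $$V^h_{Ray}(K)=\operatorname{span}_{\mathbb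 C}\{\varphi_j(\mathbf x)\,e^{ik_j\widehat{\mathbf d}{}_j^h\cdot\mathbf x}:\ \mathbf x_j\text{ a vertex of }K\},$$ $$V^h_{Ray}(\mathcal T_h)=\{v\in C^0(\overline\Omega):\ v|_K\in V^h_{Ray}(K)\ \ \forall K\in\mathcal T_h\}.$$ 1. There is a constant $C$ depending only on $\Omega$ such that in all these situations $$\inf_{u_h\in V^h_{Ray}(\mathcal T_h)}\|u-u_h\|_{L^2(\Omega)}\le C\Big(h^2|A|_{H^2(\Omega)}+\omega h^2\|A\|_{L^\infty(\Omega)}\|\nabla^2\phi\|_{L^\infty(\Omega)}+C_1\,\omega^{1/2}h\,\|A\|_{L^\infty(\Omega)}\|c^{-1}\|_{L^\infty(\Omega)}+C_0\,\omega^{-1}\Big).$$ 2. There is a constant $C$ depending only on $\Omega,A,\phi,c,C_0,C_1$ (not on $\omega$, $h$, the mesh, $u$ or the estimated directions) such that for all $\omega,h>0$ $$\inf_{u_h\in V^h_{Ray}(\mathcal T_h)}\|u-u_h\|_{L^2(\Omega)}\le C\,\big(h^2+\omega h^2+\omega^{1/2}h+\omega^{-1}\big).$$ 3. For all $\kappa$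 and $\omega_0>0$ there is a constant $C$ depending only on $\Omega,A,\phi,c,C_0,C_1,\kappa,\omega_0$ such that, whenever $\omega\ge\omega_0$ and $\omega h\le\kappa$, $$\inf_{u_h\in V^h_{Ray}(\mathcal T_h)}\|u-u_h\|_{L^2(\Omega)}\le C\,\omega^{-1/2}.$$ -/

import Mathlib

open MeasureTheory
open scoped ENNReal NNReal

/-- The Euclidean plane `ℝ²`. -/
abbrev Plane : Type := EuclideanSpace ℝ (Fin 2)

/-- A conforming triangulation of (the closure of) `Ω`: a finite simplicial complex in the plane,
all of whose simplices are faces of triangles, which fills the closure of `Ω`. -/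
structure TriangularMesh (Ω : Set Plane) where
  complex : Geometry.SimplicialComplex ℝ Plane
  finite_faces : complex.faces.Finite
  exists_triangle : ∀ s ∈ complex.faces, ∃ K ∈ complex.faces, s ⊆ K ∧ K.card = 3
  space_eq : complex.space = closure Ω

namespace TriangularMesh

variable {Ω : Set Plane} (T : TriangularMesh Ω)

/-- The elements of the mesh, each given by its set of three vertices. -/
def triangles : Set (Finset Plane) := {K | K ∈ T.complex.faces ∧ K.card = 3}

/-- The nodes of the mesh. -/
def nodes : Set Plane := T.complex.vertices

/-- The mesh width is at most `h`: every element has diameter at most `h`. -/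
def WidthLE (h : ℝ) : Prop :=
  ∀ K ∈ T.triangles, Metric.diam (convexHull ℝ (K : Set Plane)) ≤ h

end TriangularMesh

/-- The vertices of a nondegenerate triangle form an affine basis of the plane. -/
noncomputable def triangleBasis (K : Finset Plane)
    (hK : AffineIndependent ℝ ((↑) : K → Plane)) (hcard : K.card = 3) :
    AffineBasis K ℝ Plane :=
  ⟨(↑), hK, (hK.affineSpan_eq_top_iff_card_eq_finrank_add_one).2 (by
    rw [Fintype.card_coe, hcard, finrank_euclideanSpace_fin])⟩

/-- The nodal `P1` shape function of the triangle `K` attached to its vertex `p`: the affine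
function equal to `1` at `p` and to `0` at the two other vertices. -/
noncomputable def shapeFunction (K : Finset Plane)
    (hK : AffineIndependent ℝ ((↑) : K → Plane)) (hcard : K.card = 3) (p : K) : Plane →ᵃ[ℝ] ℝ :=
  (triangleBasis K hK hcard).coord p

lemma shapeFunction_vertex (K : Finset Plane)
    (hK : AffineIndependent ℝ ((↑) : K → Plane)) (hcard : K.card = 3) (p q : K) :
    shapeFunction K hK hcard p (q : Plane) = if p = q then 1 else 0 :=
  (triangleBasis K hK hcard).coord_apply p q

/-- The plane wave `x ↦ exp (i k d ⬝ x)` with wave number `k` and direction `d`. -/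
noncomputable def planeWave (k : ℝ) (d : Plane) (x : Plane) : ℂ :=
  Complex.exp (Complex.I * ((k * inner ℝ d x : ℝ) : ℂ))

/-- The local ray-based space on a triangle `K`: the complex span of the products
`φ_p(x) exp (i (ω / c(p)) d(p) ⬝ x)` over the three vertices `p` of `K`, where `φ_p` is the nodal
shape function and `d(p)` the single direction attached to `p`. -/
noncomputable def localRaySpace (ω : ℝ) (c : Plane → ℝ) (d : Plane → Plane) (K : Finset Plane)
    (hK : AffineIndependent ℝ ((↑) : K → Plane)) (hcard : K.card = 3) :
    Submodule ℂ (Plane → ℂ) :=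
  Submodule.span ℂ (Set.range fun p : K => fun x : Plane =>
    ((shapeFunction K hK hcard p x : ℝ) : ℂ) * planeWave (ω / c p) (d p) x)

/-- The global ray-FEM space built from the nodal directions `d`: functions that are continuous
on the closure of `Ω` and whose restriction to every mesh element lies in the local space.
(Only the values on the closure of `Ω` are constrained.) -/
def rayFEMSpace {Ω : Set Plane} (T : TriangularMesh Ω) (ω : ℝ) (c : Plane → ℝ)
    (d : Plane → Plane) : Submodule ℂ (Plane → ℂ) where
  carrier := {v | ContinuousOn v (closure Ω) ∧
    ∀ (K : Finset Plane) (hK : K ∈ T.triangles),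
      ∃ g ∈ localRaySpace ω c d K (T.complex.indep hK.1) hK.2,
        Set.EqOn v g (convexHull ℝ (K : Set Plane))}
  zero_mem' := ⟨continuousOn_const, fun _ _ => ⟨0, Submodule.zero_mem _, fun _ _ => rfl⟩⟩
  add_mem' := by
    rintro v w ⟨hv, hv'⟩ ⟨hw, hw'⟩
    refine ⟨hv.add hw, fun K hK => ?_⟩
    obtain ⟨g, hg, hvg⟩ := hv' K hK
    obtain ⟨g', hg', hwg⟩ := hw' K hK
    exact ⟨g + g', Submodule.add_mem _ hg hg', fun x hx => by
      simp only [Pi.add_apply, hvg hx, hwg hx]⟩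
  smul_mem' := by
    rintro a v ⟨hv, hv'⟩
    refine ⟨hv.const_smul a, fun K hK => ?_⟩
    obtain ⟨g, hg, hvg⟩ := hv' K hK
    exact ⟨a • g, Submodule.smul_mem _ a hg, fun x hx => by
      simp only [Pi.smul_apply, hvg hx]⟩

/-- The best approximation error `inf_{v ∈ V} ‖u - v‖_{L²(Ω)}`, with values in `[0, ∞]`. -/
noncomputable def bestL2Error (Ω : Set Plane) (u : Plane → ℂ) (V : Submodule ℂ (Plane → ℂ)) :
    ℝ≥0∞ :=
  ⨅ v ∈ V, eLpNorm (u - v) 2 (volume.restrict Ω)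

/-- Frequency-independent amplitude `A`, phase `φ` and wave speed `c` of a single wave front on
`Ω`: `A` and `φ` are twice continuously differentiable up to the boundary, `c` is positive, and
the eikonal equation `|∇φ| = 1 / c` holds. -/
structure IsSingleWaveFront (Ω : Set Plane) (A : Plane → ℂ) (φ c : Plane → ℝ) : Prop where
  amplitude : ContDiffOn ℝ 2 A (closure Ω)
  phase : ContDiffOn ℝ 2 φ (closure Ω)
  speed_pos : ∀ x ∈ closure Ω, 0 < c x
  eikonal : ∀ x ∈ closure Ω, ‖gradientWithin φ (closure Ω) x‖ = 1 / c x

/-- The exact ray direction `∇φ(x) / |∇φ(x)|`. -/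
noncomputable def rayDirection (Ω : Set Plane) (φ : Plane → ℝ) (x : Plane) : Plane :=
  ‖gradientWithin φ (closure Ω) x‖⁻¹ • gradientWithin φ (closure Ω) x

/-- `u ∈ L²(Ω)` agrees with `A exp (i ω φ)` up to `C₀ / ω` in `L²(Ω)`. -/
def GeometricOpticsAnsatz (Ω : Set Plane) (A : Plane → ℂ) (φ : Plane → ℝ) (C₀ ω : ℝ)
    (u : Plane → ℂ) : Prop :=
  MemLp u 2 (volume.restrict Ω) ∧
    eLpNorm (fun x => u x - A x * Complex.exp (Complex.I * ((ω * φ x : ℝ) : ℂ))) 2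
      (volume.restrict Ω) ≤ ENNReal.ofReal (C₀ / ω)

/-- The estimated direction at every node of the mesh differs from the exact ray direction by at
most `C₁ ω^{-1/2}`. -/
def DirectionsWithin {Ω : Set Plane} (T : TriangularMesh Ω) (φ : Plane → ℝ) (C₁ ω : ℝ)
    (d : Plane → Plane) : Prop :=
  ∀ p ∈ T.nodes, ‖rayDirection Ω φ p - d p‖ ≤ C₁ * ω ^ (-(1 / 2) : ℝ)

/-- The essential supremum norm on `Ω`. -/
noncomputable def normLinf {F : Type} [NormedAddCommGroup F] (Ω : Set Plane) (f : Plane → F) :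
    ℝ≥0∞ :=
  eLpNorm f ∞ (volume.restrict Ω)

/-- The seminorm `|f|_{H²(Ω)} = ‖∇²f‖_{L²(Ω)}`, for `f` twice differentiable in `Ω`. -/
noncomputable def seminormH2 (Ω : Set Plane) (f : Plane → ℂ) : ℝ≥0∞ :=
  eLpNorm (iteratedFDeriv ℝ 2 f) 2 (volume.restrict Ω)

/-! The competitor is a ray interpolant: on each triangle it is `∑ φ_p(x) a_p exp(i k_p d_p·x)`,
where `a_p` makes the wave attached to the vertex `p` take the value `A(p) exp(iωφ(p))` at `p`. With
`I A` the nodal interpolant of the amplitude and `v` this competitor, the error splits as `u - v =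
(u - A e^{iωφ}) + e^{iωφ}(A - I A) + (e^{iωφ} I A - v)`.

The first summand is the ansatz. The second is `P1` interpolation, since the exponential has modulus
one. Expanding `A` about `x` towards the three vertices cancels the linear terms and leaves averages
of the Hessian along segments to a vertex. By Cauchy–Schwarz, Fubini and the contraction towards
that vertex, such an average does not increase the `L²` norm (`setLIntegral_sq_segment_le`). No
angle condition on the mesh enters, and the constant is absolute.

The third summand is bounded pointwise (`phase_error_le`). By the eikonal equation `k_p` times the
exact ray direction is `ω∇φ(p)`, so the phase mismatch is `ω` times a second order Taylor remainder,
`O(h²)`, plus an angular error `O(ω^{-1/2} h)`. The shape functions are convex weights, so summing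
over the vertices adds no factor, and passing from a sup bound to `L²(Ω)` costs `|Ω|^{1/2}`.

Conformity makes the piecewise formula single-valued on shared faces (`glue_eq`), hence continuous
and an element of the global space. -/

/-! ### Taylor remainders and averages along segments. -/

/-- Second order Taylor formula with integral remainder along a segment of `S` whose relative
interior lies in the interior of `S`. -/
lemma ContDiffOn.taylor_segment {F : Type*} [NormedAddCommGroup F] [NormedSpace ℝ F]
    [CompleteSpace F] {S : Set Plane} {f : Plane → F}
    (hf : ContDiffOn ℝ 2 f S) (hS : UniqueDiffOn ℝ S) {a b : Plane} (ha : a ∈ S) (hb : b ∈ S)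
    (hab : ∀ t ∈ Set.Ioo (0 : ℝ) 1, a + t • (b - a) ∈ interior S) :
    f b - f a - fderivWithin ℝ f S a (b - a) =
      ∫ t in (0 : ℝ)..1, (1 - t) •
        iteratedFDerivWithin ℝ 2 f S (a + t • (b - a)) ![b - a, b - a] := by
  set v := b - a with hv
  have hmaps : Set.MapsTo (fun t : ℝ => a + t • v) (Set.Icc 0 1) S := by
    intro t ht
    rcases eq_or_lt_of_le ht.1 with h0 | h0
    · simpa [← h0] using ha
    rcases eq_or_lt_of_le ht.2 with h1 | h1
    · simpa [h1, hv] using hb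
    · exact interior_subset (hab t ⟨h0, h1⟩)
  have hline : Continuous fun t : ℝ => a + t • v := by fun_prop
  have hD1 : ContDiffOn ℝ 1 (fderivWithin ℝ f S) S := hf.fderivWithin hS (by norm_num)
  have hD1c : ContinuousOn (fun t : ℝ => fderivWithin ℝ f S (a + t • v) v) (Set.Icc 0 1) :=
    (hD1.continuousOn.comp hline.continuousOn hmaps).clm_apply continuousOn_const
  have hD2c : ContinuousOn
      (fun t : ℝ => iteratedFDerivWithin ℝ 2 f S (a + t • v) ![v, v]) (Set.Icc 0 1) := by
    have h := (hf.continuousOn_iteratedFDerivWithin (m := 2) le_rfl hS).comp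
      hline.continuousOn hmaps
    exact (ContinuousMultilinearMap.apply ℝ (fun _ : Fin 2 => Plane) F
      ![v, v]).continuous.comp_continuousOn h
  -- The remainder has the explicit antiderivative `f(a + tv) + (1 - t) Df(a + tv) v`: the two first
  -- order terms cancel in its derivative. Differentiability is needed only for `0 < t < 1`, so the
  -- endpoints may lie on the boundary of `S`.
  have hderiv : ∀ t ∈ Set.Ioo (0 : ℝ) 1, HasDerivAt
      (fun t : ℝ => f (a + t • v) + (1 - t) • fderivWithin ℝ f S (a + t • v) v)
      ((1 - t) • iteratedFDerivWithin ℝ 2 f S (a + t • v) ![v, v]) t := by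
    intro t ht
    have hint := hab t ht
    have hmem := interior_subset hint
    have hnhds : S ∈ nhds (a + t • v) := mem_interior_iff_mem_nhds.1 hint
    have hl : HasDerivAt (fun t : ℝ => a + t • v) v t := by
      simpa using ((hasDerivAt_id t).smul_const v).const_add a
    have h1 : HasFDerivAt f (fderivWithin ℝ f S (a + t • v)) (a + t • v) :=
      ((hf.differentiableOn (by norm_num)) _ hmem).hasFDerivWithinAt.hasFDerivAt hnhds
    have h2 : HasFDerivAt (fderivWithin ℝ f S)
        (fderivWithin ℝ (fderivWithin ℝ f S) S (a + t • v)) (a + t • v) :=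
      ((hD1.differentiableOn (by norm_num)) _ hmem).hasFDerivWithinAt.hasFDerivAt hnhds
    have h1' : HasDerivAt (fun t : ℝ => f (a + t • v)) (fderivWithin ℝ f S (a + t • v) v) t :=
      h1.comp_hasDerivAt t hl
    have h2' : HasDerivAt (fun t : ℝ => fderivWithin ℝ f S (a + t • v) v)
        (fderivWithin ℝ (fderivWithin ℝ f S) S (a + t • v) v v) t := by
      have h : HasDerivAt (fun t : ℝ => fderivWithin ℝ f S (a + t • v))
        (fderivWithin ℝ (fderivWithin ℝ f S) S (a + t • v) v) t := h2.comp_hasDerivAt t hl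
      exact (ContinuousLinearMap.apply ℝ F v).hasFDerivAt.comp_hasDerivAt t h
    have h3 : HasDerivAt (fun t : ℝ => 1 - t) (-1) t := (hasDerivAt_id t).const_sub 1
    rw [iteratedFDerivWithin_two_apply f hS hmem]
    refine (h1'.fun_add (h3.fun_smul h2')).congr_deriv ?_
    simp
  have hcont : ContinuousOn
      (fun t : ℝ => f (a + t • v) + (1 - t) • fderivWithin ℝ f S (a + t • v) v) (Set.Icc 0 1) :=
    (hf.continuousOn.comp hline.continuousOn hmaps).add
      ((continuous_const.sub continuous_id).continuousOn.smul hD1c)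
  rw [intervalIntegral.integral_eq_sub_of_hasDerivAt_of_le zero_le_one hcont hderiv]
  · simp [hv]
    abel
  · apply ContinuousOn.intervalIntegrable
    rw [Set.uIcc_of_le zero_le_one]
    exact (continuous_const.sub continuous_id).continuousOn.smul hD2c

lemma ContDiffOn.enorm_taylor_segment_le {F : Type*} [NormedAddCommGroup F] [NormedSpace ℝ F]
    [CompleteSpace F] {S : Set Plane} {f : Plane → F}
    (hf : ContDiffOn ℝ 2 f S) (hS : UniqueDiffOn ℝ S) {a b : Plane} (ha : a ∈ S) (hb : b ∈ S)
    (hab : ∀ t ∈ Set.Ioo (0 : ℝ) 1, a + t • (b - a) ∈ interior S) {h : ℝ} (hh : ‖b - a‖ ≤ h) :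
    ‖f b - f a - fderivWithin ℝ f S a (b - a)‖ₑ ≤
      ENNReal.ofReal (h ^ 2) * ∫⁻ t in Set.Ioo (0 : ℝ) 1, ENNReal.ofReal (1 - t) *
        ‖iteratedFDerivWithin ℝ 2 f S (a + t • (b - a))‖ₑ := by
  rw [hf.taylor_segment hS ha hb hab, intervalIntegral.integral_of_le zero_le_one,
    ← integral_Ioc_eq_integral_Ioo.symm, ← lintegral_const_mul' _ _ ENNReal.ofReal_ne_top]
  refine (enorm_integral_le_lintegral_enorm _).trans ?_
  refine setLIntegral_mono' measurableSet_Ioo fun t ht => ?_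
  have h1 : ‖iteratedFDerivWithin ℝ 2 f S (a + t • (b - a)) ![b - a, b - a]‖ ≤
      h ^ 2 * ‖iteratedFDerivWithin ℝ 2 f S (a + t • (b - a))‖ := by
    refine (ContinuousMultilinearMap.le_opNorm _ _).trans ?_
    rw [mul_comm]
    gcongr
    simp only [Fin.prod_univ_two, Matrix.cons_val_zero, Matrix.cons_val_one, ← sq]
    gcongr
  have h0 : 0 ≤ 1 - t := by linarith [ht.2]
  rw [← ofReal_norm, ← ofReal_norm, ← ENNReal.ofReal_mul h0, ← ENNReal.ofReal_mul (sq_nonneg h),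
    norm_smul, Real.norm_of_nonneg h0]
  apply ENNReal.ofReal_le_ofReal
  nlinarith

/-- Cauchy-Schwarz inequality on the unit interval. -/
lemma sq_setLIntegral_Ioo_le {g : ℝ → ℝ≥0∞} (hg : AEMeasurable g (volume.restrict (Set.Ioo 0 1))) :
    (∫⁻ t in Set.Ioo (0 : ℝ) 1, g t) ^ 2 ≤ ∫⁻ t in Set.Ioo (0 : ℝ) 1, g t ^ 2 := by
  have h := ENNReal.lintegral_mul_le_Lp_mul_Lq (volume.restrict (Set.Ioo (0 : ℝ) 1))
    Real.HolderConjugate.two_two hg (aemeasurable_const (b := (1 : ℝ≥0∞)))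
  simp only [Pi.mul_apply, mul_one, ENNReal.one_rpow, lintegral_const, MeasurableSet.univ,
    Measure.restrict_apply, Set.univ_inter, Real.volume_Ioo, sub_zero, ENNReal.ofReal_one,
    ENNReal.rpow_two, one_pow] at h
  calc _ ≤ ((∫⁻ t in Set.Ioo (0 : ℝ) 1, g t ^ 2) ^ (1 / 2 : ℝ)) ^ 2 := by gcongr
    _ = _ := by rw [← ENNReal.rpow_two, ← ENNReal.rpow_mul]; norm_num

/-- Change of variables for a contraction of the plane towards the point `p`. -/
lemma lintegral_contraction {F : Plane → ℝ≥0∞} (hF : Measurable F) (p : Plane) {t : ℝ}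
    (ht : t < 1) :
    ENNReal.ofReal (1 - t) ^ 2 * ∫⁻ x, F (x + t • (p - x)) = ∫⁻ x, F x := by
  have h0 : 0 < 1 - t := by linarith
  have h1 : ∀ x, F (x + t • (p - x)) = (fun y => F (y + t • p)) ((1 - t) • x) := by
    intro x
    congr 1
    module
  have hm : Measurable fun y => F (y + t • p) := hF.comp (measurable_add_const _)
  simp_rw [h1]
  rw [← lintegral_map hm (measurable_const_smul (1 - t)),
    Measure.map_addHaar_smul _ h0.ne', lintegral_smul_measure, lintegral_add_right_eq_self,
    finrank_euclideanSpace_fin, abs_of_pos (by positivity), smul_eq_mul, ← mul_assoc,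
    ← ENNReal.ofReal_pow h0.le, ← ENNReal.ofReal_mul (by positivity), mul_inv_cancel₀ (by positivity)]
  simp

/-- Averaging a function along the segments joining the points of an open set to the point `p`
does not increase its `L²` norm, if the set is star-shaped about `p`. -/
lemma setLIntegral_sq_segment_le {U : Set Plane} (hU : IsOpen U) {p : Plane}
    (hp : ∀ x ∈ U, ∀ t ∈ Set.Ioo (0 : ℝ) 1, x + t • (p - x) ∈ U) {F : Plane → ℝ≥0∞}
    (hF : Measurable (U.indicator F)) :
    ∫⁻ x in U, (∫⁻ t in Set.Ioo (0 : ℝ) 1, ENNReal.ofReal (1 - t) * F (x + t • (p - x))) ^ 2 ≤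
      ∫⁻ x in U, F x ^ 2 := by
  set G := U.indicator F with hG
  have hmeas : Measurable fun z : Plane × ℝ =>
      (ENNReal.ofReal (1 - z.2) * G (z.1 + z.2 • (p - z.1))) ^ 2 := by
    have : Measurable fun z : Plane × ℝ => z.1 + z.2 • (p - z.1) := by fun_prop
    have := hF.comp this
    have h2 : Measurable fun z : Plane × ℝ => ENNReal.ofReal (1 - z.2) := by fun_prop
    exact (h2.mul this).pow_const 2
  calc _ ≤ ∫⁻ x in U, ∫⁻ t in Set.Ioo (0 : ℝ) 1,
        (ENNReal.ofReal (1 - t) * G (x + t • (p - x))) ^ 2 := by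
        refine setLIntegral_mono' hU.measurableSet fun x hx => ?_
        -- By star-shapedness the segment stays in `U`, so `F` may be replaced by its extension by
        -- zero, which is measurable on the whole plane.
        rw [setLIntegral_congr_fun (g := fun t => ENNReal.ofReal (1 - t) * G (x + t • (p - x)))
          measurableSet_Ioo fun t ht => by
            simp only [hG, Set.indicator_of_mem (hp x hx t ht)]]
        apply sq_setLIntegral_Ioo_le
        have h1 : Measurable fun t : ℝ => x + t • (p - x) := by fun_prop
        have h2 : Measurable fun t : ℝ => ENNReal.ofReal (1 - t) := by fun_prop
        exact (h2.mul (hF.comp h1)).aemeasurable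
    _ = ∫⁻ t in Set.Ioo (0 : ℝ) 1, ∫⁻ x in U,
        (ENNReal.ofReal (1 - t) * G (x + t • (p - x))) ^ 2 :=
        lintegral_lintegral_swap hmeas.aemeasurable
    _ ≤ ∫⁻ t in Set.Ioo (0 : ℝ) 1, ∫⁻ x, G x ^ 2 := by
        refine setLIntegral_mono' measurableSet_Ioo fun t ht => ?_
        refine (setLIntegral_le_lintegral _ _).trans ?_
        simp_rw [mul_pow]
        -- The squared Taylor weight `(1 - t)²` is exactly the Jacobian of the contraction in
        -- dimension two, so no singularity at `t = 1` remains.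
        rw [lintegral_const_mul', ← lintegral_contraction (hF.pow_const 2) p ht.2]
        exact ENNReal.pow_ne_top ENNReal.ofReal_ne_top
    _ = ∫⁻ x in U, F x ^ 2 := by
        rw [← lintegral_indicator hU.measurableSet]
        simp only [lintegral_const, MeasurableSet.univ, Measure.restrict_apply, Set.univ_inter,
          Real.volume_Ioo, sub_zero, ENNReal.ofReal_one, mul_one]
        congr 1 with x
        by_cases hx : x ∈ U <;> simp [hG, hx]

/-! ### Barycentric coordinates on a triangle. -/

lemma AffineMap.map_sum_smul {ι E : Type*} [AddCommGroup E] [Module ℝ E] (f : E →ᵃ[ℝ] ℝ)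
    (s : Finset ι) (μ : ι → ℝ) (z : ι → E) (hμ : ∑ i ∈ s, μ i = 1) :
    f (∑ i ∈ s, μ i • z i) = ∑ i ∈ s, μ i * f (z i) := by
  have h : ∀ y, f y = f.linear y + f 0 := fun y => congrFun f.decomp y
  have h2 : ∑ i ∈ s, μ i * f (z i) = ∑ i ∈ s, (μ i * f.linear (z i) + μ i * f 0) :=
    Finset.sum_congr rfl fun i _ => by rw [h (z i), mul_add]
  rw [h2, h, Finset.sum_add_distrib, ← Finset.sum_mul, hμ, one_mul, map_sum]
  simp only [map_smul, smul_eq_mul]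

section shapeFunction

variable {K : Finset Plane} {hK : AffineIndependent ℝ ((↑) : K → Plane)} {hcard : K.card = 3}

lemma sum_shapeFunction (x : Plane) : ∑ p, shapeFunction K hK hcard p x = 1 :=
  (triangleBasis K hK hcard).sum_coord_apply_eq_one x

lemma sum_shapeFunction_smul (x : Plane) : ∑ p, shapeFunction K hK hcard p x • (p : Plane) = x :=
  (triangleBasis K hK hcard).linear_combination_coord_eq_self x

lemma shapeFunction_nonneg (p : K) {x : Plane} (hx : x ∈ convexHull ℝ (K : Set Plane)) :
    0 ≤ shapeFunction K hK hcard p x := by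
  have h := (triangleBasis K hK hcard).convexHull_eq_nonneg_coord
  have hr : Set.range (triangleBasis K hK hcard) = (K : Set Plane) := Subtype.range_coe
  rw [hr] at h
  rw [h] at hx
  exact hx p

lemma continuous_shapeFunction (p : K) : Continuous (shapeFunction K hK hcard p) :=
  (shapeFunction K hK hcard p).continuous_of_finiteDimensional

lemma nonempty_interior_triangle (hK : AffineIndependent ℝ ((↑) : K → Plane))
    (hcard : K.card = 3) : (interior (convexHull ℝ (K : Set Plane))).Nonempty := by
  have hr : Set.range (triangleBasis K hK hcard) = (K : Set Plane) := Subtype.range_coe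
  rw [interior_convexHull_nonempty_iff_affineSpan_eq_top, ← hr]
  exact (triangleBasis K hK hcard).tot

/-- A sum weighted by shape functions, evaluated at a convex combination of some of the vertices. -/
lemma sum_shapeFunction_mul {s : Finset Plane} (hs : s ⊆ K) {μ : Plane → ℝ}
    (hμ : ∑ q ∈ s, μ q = 1) {x : Plane} (hx : ∑ q ∈ s, μ q • q = x) (w : Plane → ℂ) :
    ∑ p : K, ((shapeFunction K hK hcard p x : ℝ) : ℂ) * w p = ∑ q ∈ s, (μ q : ℂ) * w q := by
  -- The barycentric coordinates of `x` in `K` are the weights `μ` on `s`, and zero at the vertices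
  -- outside `s`.
  have h : ∀ p : K, shapeFunction K hK hcard p x = ∑ q ∈ s, μ q * if (p : Plane) = q then 1 else 0 := by
    intro p
    rw [← hx, AffineMap.map_sum_smul _ _ _ _ hμ]
    refine Finset.sum_congr rfl fun q hq => ?_
    have := shapeFunction_vertex K hK hcard p ⟨q, hs hq⟩
    simp only [Subtype.ext_iff] at this
    rw [this]
  calc _ = ∑ p ∈ K, (∑ q ∈ s, (μ q : ℂ) * if p = q then 1 else 0) * w p := by
        rw [← Finset.sum_coe_sort K]
        refine Finset.sum_congr rfl fun p _ => ?_
        rw [h p]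
        push_cast
        simp only [Complex.ofReal_zero, Complex.ofReal_one, apply_ite Complex.ofReal]
    _ = ∑ q ∈ s, ∑ p ∈ K, (μ q : ℂ) * (if p = q then 1 else 0) * w p := by
        simp_rw [Finset.sum_mul]
        exact Finset.sum_comm
    _ = _ := by
        refine Finset.sum_congr rfl fun q hq => ?_
        rw [Finset.sum_eq_single q]
        · simp
        · intro p _ hpq
          simp [hpq]
        · intro hq'
          exact absurd (hs hq) hq'

end shapeFunction

/-! ### Geometry of the mesh and gluing of local functions. -/

namespace TriangularMesh

variable {Ω : Set Plane} (T : TriangularMesh Ω)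

lemma finite_triangles : T.triangles.Finite := T.finite_faces.subset fun _ h => h.1

variable {T}

lemma mem_nodes {K : Finset Plane} (hK : K ∈ T.triangles) {p : Plane} (hp : p ∈ K) :
    p ∈ T.nodes :=
  T.complex.down_closed hK.1 (Finset.singleton_subset_iff.2 hp) (Finset.singleton_nonempty p)

lemma convexHull_subset_closure {K : Finset Plane} (hK : K ∈ T.triangles) :
    convexHull ℝ (K : Set Plane) ⊆ closure Ω := by
  rw [← T.space_eq]
  exact T.complex.convexHull_subset_space hK.1

lemma interior_triangle_subset (hΩ : interior (closure Ω) = Ω) {K : Finset Plane}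
    (hK : K ∈ T.triangles) : interior (convexHull ℝ (K : Set Plane)) ⊆ Ω :=
  hΩ ▸ interior_mono (convexHull_subset_closure hK)

lemma nonempty_interior {K : Finset Plane} (hK : K ∈ T.triangles) :
    (interior (convexHull ℝ (K : Set Plane))).Nonempty :=
  nonempty_interior_triangle (T.complex.indep hK.1) hK.2

lemma isCompact_triangle (K : Finset Plane) : IsCompact (convexHull ℝ (K : Set Plane)) :=
  K.finite_toSet.isCompact_convexHull ℝ

lemma dist_le {h : ℝ} (hT : T.WidthLE h) {K : Finset Plane} (hK : K ∈ T.triangles) {x y : Plane}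
    (hx : x ∈ convexHull ℝ (K : Set Plane)) (hy : y ∈ convexHull ℝ (K : Set Plane)) :
    ‖x - y‖ ≤ h := by
  rw [← dist_eq_norm]
  exact (Metric.dist_le_diam_of_mem (isCompact_triangle K).isBounded hx hy).trans (hT K hK)

variable (T)

lemma exists_mem_triangle {x : Plane} (hx : x ∈ closure Ω) :
    ∃ K ∈ T.triangles, x ∈ convexHull ℝ (K : Set Plane) := by
  rw [← T.space_eq, T.complex.mem_space_iff] at hx
  obtain ⟨s, hs, hxs⟩ := hx
  obtain ⟨K, hK, hsK, hc⟩ := T.exists_triangle s hs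
  exact ⟨K, ⟨hK, hc⟩, convexHull_mono (Finset.coe_subset.2 hsK) hxs⟩

/-- Each point lies in a triangle, a convex set with nonempty interior contained in the closure. The
mesh thus supplies the regularity of `closure Ω` that derivatives up to the boundary require. -/
lemma uniqueDiffOn_closure (T : TriangularMesh Ω) : UniqueDiffOn ℝ (closure Ω) := by
  intro x hx
  obtain ⟨K, hK, hxK⟩ := T.exists_mem_triangle hx
  exact (uniqueDiffWithinAt_convex (convex_convexHull ℝ _) (nonempty_interior hK)
    (subset_closure hxK)).mono (convexHull_subset_closure hK)

/-- Two triangles meet inside the hull of their common vertices. Distinct triangles share at most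
two, too few to span the plane, so this hull has empty interior. -/
lemma disjoint_interior {K L : Finset Plane} (hK : K ∈ T.triangles) (hL : L ∈ T.triangles)
    (hKL : K ≠ L) : Disjoint (interior (convexHull ℝ (K : Set Plane)))
      (interior (convexHull ℝ (L : Set Plane))) := by
  rw [Set.disjoint_iff_inter_eq_empty, ← interior_inter, ← Set.not_nonempty_iff_eq_empty]
  intro h
  have h1 : (interior (convexHull ℝ ((K ∩ L : Finset Plane) : Set Plane))).Nonempty := by
    rw [Finset.coe_inter]
    exact h.mono (interior_mono (T.complex.inter_subset_convexHull hK.1 hL.1))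
  rw [interior_convexHull_nonempty_iff_affineSpan_eq_top] at h1
  have hlt : (K ∩ L).card < 3 := by
    rw [← hK.2]
    refine Finset.card_lt_card (Finset.inter_subset_left.ssubset_of_ne fun he => hKL ?_)
    exact Finset.eq_of_subset_of_card_le (Finset.inter_eq_left.1 he) (by rw [hK.2, hL.2])
  have hind : AffineIndependent ℝ ((↑) : (K ∩ L : Finset Plane) → Plane) :=
    (T.complex.indep hK.1).mono (Finset.coe_subset.2 Finset.inter_subset_left)
  have h2 := (hind.affineSpan_eq_top_iff_card_eq_finrank_add_one).1 (by
    rw [Subtype.range_coe]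
    exact h1)
  rw [Fintype.card_coe, finrank_euclideanSpace_fin] at h2
  omega

open Classical in
/-- The function on the closure of `Ω` given on every mesh triangle `K` by
`∑ φ_p(x) w(p, x)`, the sum running over the vertices `p` of `K`. -/
noncomputable def glue (w : Plane → Plane → ℂ) (x : Plane) : ℂ :=
  if h : ∃ K, K ∈ T.triangles ∧ x ∈ convexHull ℝ (K : Set Plane) then
    ∑ p : h.choose, ((shapeFunction h.choose (T.complex.indep h.choose_spec.1.1)
      h.choose_spec.1.2 p x : ℝ) : ℂ) * w p x
  else 0

/-- The triangle chosen in `glue` is irrelevant: a point of two triangles is a convex combination of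
their common vertices, and both sums collapse to the same sum over these. This holds because `w p`
depends on the node and not on the triangle. -/
lemma glue_eq (w : Plane → Plane → ℂ) {K : Finset Plane} (hK : K ∈ T.triangles) {x : Plane}
    (hx : x ∈ convexHull ℝ (K : Set Plane)) :
    T.glue w x =
      ∑ p : K, ((shapeFunction K (T.complex.indep hK.1) hK.2 p x : ℝ) : ℂ) * w p x := by
  have h : ∃ K, K ∈ T.triangles ∧ x ∈ convexHull ℝ (K : Set Plane) := ⟨K, hK, hx⟩
  rw [glue, dif_pos h]
  have hm : x ∈ convexHull ℝ ((h.choose ∩ K : Finset Plane) : Set Plane) := by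
    rw [Finset.coe_inter]
    exact T.complex.inter_subset_convexHull h.choose_spec.1.1 hK.1 ⟨h.choose_spec.2, hx⟩
  obtain ⟨μ, -, hμ, hμx⟩ := Finset.mem_convexHull'.1 hm
  rw [sum_shapeFunction_mul Finset.inter_subset_left hμ hμx fun p => w p x,
    sum_shapeFunction_mul Finset.inter_subset_right hμ hμx fun p => w p x]

lemma continuous_sum_shapeFunction_mul {w : Plane → Plane → ℂ} (hw : ∀ p, Continuous (w p))
    {K : Finset Plane} (hK : AffineIndependent ℝ ((↑) : K → Plane)) (hcard : K.card = 3) :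
    Continuous fun x => ∑ p : K, ((shapeFunction K hK hcard p x : ℝ) : ℂ) * w p x := by
  refine continuous_finsetSum _ fun p _ => Continuous.mul ?_ (hw p)
  exact Complex.continuous_ofReal.comp (continuous_shapeFunction p)

/-- The triangles form a finite closed cover, and on each one the glued function is a continuous
expression. -/
lemma continuousOn_glue {w : Plane → Plane → ℂ} (hw : ∀ p, Continuous (w p)) :
    ContinuousOn (T.glue w) (closure Ω) := by
  have : Finite T.triangles := T.finite_triangles
  have hcov : closure Ω ⊆ ⋃ K : T.triangles, convexHull ℝ ((K : Finset Plane) : Set Plane) := by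
    intro x hx
    obtain ⟨K, hK, hxK⟩ := T.exists_mem_triangle hx
    exact Set.mem_iUnion.2 ⟨⟨K, hK⟩, hxK⟩
  have hcont : ∀ K : T.triangles,
      ContinuousOn (T.glue w) (convexHull ℝ ((K : Finset Plane) : Set Plane)) := fun K =>
    (continuous_sum_shapeFunction_mul hw (T.complex.indep K.2.1) K.2.2).continuousOn.congr
      fun x hx => T.glue_eq w K.2 hx
  have hclosed : ∀ K : T.triangles,
      IsClosed (convexHull ℝ ((K : Finset Plane) : Set Plane)) := fun K =>
    (isCompact_triangle K.1).isClosed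
  have h := LocallyFinite.continuousOn_iUnion (locallyFinite_of_finite _) hclosed hcont
  exact h.mono hcov

lemma continuous_planeWave (k : ℝ) (d : Plane) : Continuous (planeWave k d) := by
  unfold planeWave
  fun_prop

/-- Gluing multiples of the plane waves attached to the nodes gives a ray-FEM function. -/
lemma glue_mem_rayFEMSpace (ω : ℝ) (c : Plane → ℝ) (d : Plane → Plane) (a : Plane → ℂ) :
    T.glue (fun p x => a p * planeWave (ω / c p) (d p) x) ∈ rayFEMSpace T ω c d := by
  refine ⟨T.continuousOn_glue fun p => continuous_const.mul (continuous_planeWave _ _),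
    fun K hK => ?_⟩
  refine ⟨∑ p : K, a p • fun x : Plane =>
    ((shapeFunction K (T.complex.indep hK.1) hK.2 p x : ℝ) : ℂ) * planeWave (ω / c p) (d p) x,
    Submodule.sum_mem _ fun p _ => Submodule.smul_mem _ _ (Submodule.subset_span ⟨p, rfl⟩),
    fun x hx => ?_⟩
  rw [T.glue_eq _ hK hx]
  simp only [Finset.sum_apply, Pi.smul_apply, smul_eq_mul]
  exact Finset.sum_congr rfl fun p _ => by ring

/-- The integral over `Ω` is controlled by the integrals over the open triangles. -/
lemma lintegral_le_sum_triangles (g : Plane → ℝ≥0∞) :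
    ∫⁻ x in Ω, g x ≤ ∑ K ∈ T.finite_triangles.toFinset,
      ∫⁻ x in interior (convexHull ℝ (K : Set Plane)), g x := by
  have hcov : Ω ⊆ ⋃ K : T.finite_triangles.toFinset,
      convexHull ℝ ((K : Finset Plane) : Set Plane) := by
    intro x hx
    obtain ⟨K, hK, hxK⟩ := T.exists_mem_triangle (subset_closure hx)
    exact Set.mem_iUnion.2 ⟨⟨K, T.finite_triangles.mem_toFinset.2 hK⟩, hxK⟩
  refine (lintegral_mono_set hcov).trans ((lintegral_iUnion_le _ _).trans ?_)
  rw [tsum_fintype, Finset.sum_coe_sort T.finite_triangles.toFinset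
    fun K => ∫⁻ x in convexHull ℝ (K : Set Plane), g x]
  refine Finset.sum_le_sum fun K _ => ?_
  rw [setLIntegral_congr (interior_ae_eq_of_null_frontier
    ((convex_convexHull ℝ _).addHaar_frontier volume)).symm]

/-- The open triangles are disjoint, and they lie in `Ω` itself, not merely in its closure, because
`Ω` is the interior of its closure. -/
lemma sum_triangles_le_lintegral (hΩ : interior (closure Ω) = Ω) (g : Plane → ℝ≥0∞) :
    ∑ K ∈ T.finite_triangles.toFinset, ∫⁻ x in interior (convexHull ℝ (K : Set Plane)), g x ≤
      ∫⁻ x in Ω, g x := by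
  rw [← lintegral_biUnion_finset]
  · exact lintegral_mono_set (Set.iUnion₂_subset fun K hK =>
      interior_triangle_subset hΩ (T.finite_triangles.mem_toFinset.1 hK))
  · intro K hK L hL hKL
    exact T.disjoint_interior (T.finite_triangles.mem_toFinset.1 hK)
      (T.finite_triangles.mem_toFinset.1 hL) hKL
  · exact fun K _ => isOpen_interior.measurableSet

end TriangularMesh

/-! ### Elementary inequalities; from essential bounds on `Ω` to pointwise bounds on its closure. -/

lemma eLpNorm_two_sq {α F : Type*} [MeasurableSpace α] [NormedAddCommGroup F] (μ : Measure α)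
    (f : α → F) : eLpNorm f 2 μ ^ 2 = ∫⁻ x, ‖f x‖ₑ ^ 2 ∂μ := by
  have h := eLpNorm_nnreal_pow_eq_lintegral (μ := μ) (f := f) (p := 2) two_ne_zero
  simpa [ENNReal.rpow_two] using h

/-- Cauchy–Schwarz with `∑ wᵢ² ≤ ∑ wᵢ = 1`. Discarding the weights lets each vertex remainder be
integrated separately. -/
lemma norm_sum_mul_sq_le {ι : Type*} [Fintype ι] {w : ι → ℝ} (hw : ∀ i, 0 ≤ w i)
    (hsum : ∑ i, w i = 1) (r : ι → ℂ) : ‖∑ i, (w i : ℂ) * r i‖ ^ 2 ≤ ∑ i, ‖r i‖ ^ 2 := by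
  have h1 : ‖∑ i, (w i : ℂ) * r i‖ ≤ ∑ i, w i * ‖r i‖ := by
    refine (norm_sum_le _ _).trans (Finset.sum_le_sum fun i _ => ?_)
    rw [norm_mul, Complex.norm_real, Real.norm_of_nonneg (hw i)]
  have hle : ∀ i, w i ≤ 1 := fun i =>
    hsum ▸ Finset.single_le_sum (fun j _ => hw j) (Finset.mem_univ i)
  have h2 : ∑ i, w i ^ 2 ≤ 1 := by
    rw [← hsum]
    exact Finset.sum_le_sum fun i _ => by nlinarith [hw i, hle i]
  have h3 := Finset.sum_mul_sq_le_sq_mul_sq Finset.univ w fun i => ‖r i‖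
  have h4 : 0 ≤ ∑ i, ‖r i‖ ^ 2 := Finset.sum_nonneg fun i _ => sq_nonneg _
  calc _ ≤ (∑ i, w i * ‖r i‖) ^ 2 := by gcongr
    _ ≤ _ := h3
    _ ≤ _ := by nlinarith

lemma norm_exp_I_mul_sub_le (a b : ℝ) :
    ‖Complex.exp (Complex.I * a) - Complex.exp (Complex.I * b)‖ ≤ |a - b| := by
  have h : Complex.exp (Complex.I * a) - Complex.exp (Complex.I * b) =
      Complex.exp (Complex.I * b) * (Complex.exp (Complex.I * ((a - b : ℝ) : ℂ)) - 1) := by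
    rw [mul_sub, ← Complex.exp_add]
    push_cast
    ring_nf
  rw [h, norm_mul, Complex.norm_exp_I_mul_ofReal, one_mul]
  exact Real.norm_exp_I_mul_ofReal_sub_one_le

section normLinf

variable {F : Type} [NormedAddCommGroup F] {Ω : Set Plane} {f : Plane → F}

/-- The points of `Ω` violating the bound form an open null set, hence none exist, and continuity
carries the bound to the closure. Values at individual nodes, possibly on the boundary, are needed
later. -/
lemma enorm_le_normLinf (hΩ : IsOpen Ω) (hf : ContinuousOn f (closure Ω)) {x : Plane}
    (hx : x ∈ closure Ω) : ‖f x‖ₑ ≤ normLinf Ω f := by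
  set N := closure Ω ∩ (fun y => ‖f y‖ₑ) ⁻¹' Set.Iic (normLinf Ω f) with hN
  have hclosed : IsClosed N := hf.enorm.preimage_isClosed_of_isClosed isClosed_closure isClosed_Iic
  suffices hsub : Ω ⊆ N from (closure_minimal hsub hclosed hx).2
  intro y hy
  by_contra hyN
  have hopen : IsOpen (Ω \ N) := hΩ.sdiff hclosed
  have hpos := hopen.measure_pos volume ⟨y, hy, hyN⟩
  have hae : ∀ᵐ z ∂volume.restrict Ω, ‖f z‖ₑ ≤ normLinf Ω f := by
    rw [normLinf, eLpNorm_exponent_top]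
    exact ae_le_eLpNormEssSup
  rw [ae_restrict_iff' hΩ.measurableSet, ae_iff] at hae
  refine hpos.ne' (measure_mono_null (fun z hz => ?_) hae)
  simp only [Set.mem_ofPred_eq, Classical.not_imp]
  exact ⟨hz.1, fun h => hz.2 ⟨subset_closure hz.1, h⟩⟩

lemma eLpNorm_ne_top_of_continuousOn_closure (hΩ : IsOpen Ω) (hb : Bornology.IsBounded Ω)
    (hf : ContinuousOn f (closure Ω)) (p : ℝ≥0∞) : eLpNorm f p (volume.restrict Ω) ≠ ∞ := by
  obtain ⟨M, hM⟩ := hb.isCompact_closure.exists_bound_of_continuousOn hf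
  have : IsFiniteMeasure (volume.restrict Ω) := ⟨by
    rw [Measure.restrict_apply_univ]
    exact hb.measure_lt_top⟩
  refine ne_top_of_le_ne_top ?_ (eLpNorm_le_of_ae_bound (C := M) ?_)
  · exact ENNReal.mul_ne_top (ENNReal.rpow_ne_top_of_nonneg (by positivity) (measure_ne_top _ _))
      ENNReal.ofReal_ne_top
  · rw [ae_restrict_iff' hΩ.measurableSet]
    exact Filter.Eventually.of_forall fun x hx => hM x (subset_closure hx)

end normLinf

/-- The norms in the theorem use the full derivative inside `Ω`, whereas the Taylor formulas use
derivatives within `closure Ω`, which are meaningful at boundary nodes too. -/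
lemma iteratedFDeriv_eq_within_closure {F : Type*} [NormedAddCommGroup F] [NormedSpace ℝ F]
    {Ω : Set Plane} (hΩ : IsOpen Ω) (f : Plane → F) {x : Plane} (hx : x ∈ Ω) :
    iteratedFDeriv ℝ 2 f x = iteratedFDerivWithin ℝ 2 f (closure Ω) x := by
  rw [← iteratedFDerivWithin_univ]
  refine (iteratedFDerivWithin_congr_set ?_ 2).symm
  exact Filter.eventuallyEq_univ.2 (Filter.mem_of_superset (hΩ.mem_nhds hx) subset_closure)

lemma ae_iteratedFDeriv_eq_within_closure {F : Type*} [NormedAddCommGroup F] [NormedSpace ℝ F]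
    {Ω : Set Plane} (hΩ : IsOpen Ω) (f : Plane → F) :
    iteratedFDeriv ℝ 2 f =ᵐ[volume.restrict Ω] iteratedFDerivWithin ℝ 2 f (closure Ω) := by
  refine (ae_restrict_iff' hΩ.measurableSet).2 (Filter.Eventually.of_forall fun x hx => ?_)
  exact iteratedFDeriv_eq_within_closure hΩ f hx

/-! ### Interpolation of the amplitude. -/

namespace TriangularMesh

variable {Ω : Set Plane} (T : TriangularMesh Ω)

lemma ae_mem_interior_triangle (hΩ : IsOpen Ω) : ∀ᵐ x ∂volume.restrict Ω,
    ∃ K ∈ T.triangles, x ∈ interior (convexHull ℝ (K : Set Plane)) := by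
  have h : ∀ᵐ x ∂(volume : Measure Plane), ∀ K ∈ T.triangles,
      x ∉ frontier (convexHull ℝ (K : Set Plane)) :=
    (ae_ball_iff T.finite_triangles.countable).2 fun K _ =>
      measure_eq_zero_iff_ae_notMem.1 ((convex_convexHull ℝ _).addHaar_frontier volume)
  refine (ae_restrict_iff' hΩ.measurableSet).2 (h.mono fun x hx hxΩ => ?_)
  obtain ⟨K, hK, hxK⟩ := T.exists_mem_triangle (subset_closure hxΩ)
  refine ⟨K, hK, ?_⟩
  by_contra hn
  exact hx K hK ⟨subset_closure hxK, hn⟩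

variable {T}

lemma segment_mem_interior {K : Finset Plane} {x y : Plane}
    (hx : x ∈ interior (convexHull ℝ (K : Set Plane))) (hy : y ∈ convexHull ℝ (K : Set Plane))
    {t : ℝ} (ht : t ∈ Set.Ioo (0 : ℝ) 1) :
    x + t • (y - x) ∈ interior (convexHull ℝ (K : Set Plane)) := by
  have h := (convex_convexHull ℝ (K : Set Plane)).combo_interior_self_mem_interior hx hy
    (a := 1 - t) (b := t) (by linarith [ht.2]) ht.1.le (by ring)
  convert h using 1
  module

/-- The error of `P1` interpolation on one triangle. -/
lemma setLIntegral_interpolation_sq_le {h : ℝ} (hT : T.WidthLE h)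
    {A : Plane → ℂ} (hA : ContDiffOn ℝ 2 A (closure Ω)) {K : Finset Plane} (hK : K ∈ T.triangles) :
    ∫⁻ x in interior (convexHull ℝ (K : Set Plane)), ‖A x - T.glue (fun p _ => A p) x‖ₑ ^ 2 ≤
      3 * ENNReal.ofReal (h ^ 2) ^ 2 * ∫⁻ x in interior (convexHull ℝ (K : Set Plane)),
        ‖iteratedFDerivWithin ℝ 2 A (closure Ω) x‖ₑ ^ 2 := by
  have hS := T.uniqueDiffOn_closure
  set U := interior (convexHull ℝ (K : Set Plane)) with hU
  set D : Plane → ℝ≥0∞ := fun x => ‖iteratedFDerivWithin ℝ 2 A (closure Ω) x‖ₑ with hD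
  have hUS : U ⊆ closure Ω := interior_subset.trans (convexHull_subset_closure hK)
  have hDc : ContinuousOn D U :=
    ((hA.continuousOn_iteratedFDerivWithin (m := 2) le_rfl hS).mono hUS).enorm
  have hDm : Measurable (U.indicator D) := by
    classical
    rw [← Set.piecewise_eq_indicator]
    exact hDc.measurable_piecewise continuousOn_const isOpen_interior.measurableSet
  have hvert : ∀ p : K, (p : Plane) ∈ convexHull ℝ (K : Set Plane) :=
    fun p => subset_convexHull ℝ _ p.2
  set r : K → Plane → ℂ :=
    fun p x => A p - A x - fderivWithin ℝ A (closure Ω) x ((p : Plane) - x) with hr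
  have hrc : ∀ p, ContinuousOn (r p) U := fun p =>
    (continuousOn_const.sub (hA.continuousOn.mono hUS)).sub
      (((hA.continuousOn_fderivWithin hS (by norm_num)).mono hUS).clm_apply
        (continuous_const.sub continuous_id).continuousOn)
  have hpt : ∀ x ∈ U, ‖A x - T.glue (fun p _ => A p) x‖ₑ ^ 2 ≤ ∑ p : K, ‖r p x‖ₑ ^ 2 := by
    intro x hx
    have hxK := interior_subset hx
    set l : K → ℝ := fun p => shapeFunction K (T.complex.indep hK.1) hK.2 p x with hl
    have hl1 : ∑ p, l p = 1 := sum_shapeFunction x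
    -- The linear Taylor terms cancel because `x` is the barycentre of the vertices with weights `l
    -- p`.
    have hl2 : ∑ p : K, (l p : ℂ) * fderivWithin ℝ A (closure Ω) x (p - x) = 0 := by
      have h1 : ∑ p : K, l p • ((p : Plane) - x) = 0 := by
        simp only [smul_sub, Finset.sum_sub_distrib, ← Finset.sum_smul, hl1, one_smul]
        rw [sub_eq_zero]
        exact sum_shapeFunction_smul x
      calc _ = fderivWithin ℝ A (closure Ω) x (∑ p : K, l p • ((p : Plane) - x)) := by
            simp only [map_sum, map_smul, Complex.real_smul]
        _ = 0 := by rw [h1, map_zero]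
    have heq : A x - T.glue (fun p _ => A p) x = -∑ p, (l p : ℂ) * r p x := by
      rw [T.glue_eq _ hK hxK]
      simp only [hr, mul_sub, Finset.sum_sub_distrib, hl2, ← Finset.sum_mul, ← Complex.ofReal_sum,
        hl1]
      simp only [hl]
      push_cast
      ring
    have hsq := norm_sum_mul_sq_le (fun p => shapeFunction_nonneg p hxK) hl1 fun p => r p x
    rw [heq, enorm_neg]
    simp only [← ofReal_norm, ← ENNReal.ofReal_pow (norm_nonneg _)]
    rw [← ENNReal.ofReal_sum_of_nonneg fun p _ => sq_nonneg _]
    exact ENNReal.ofReal_le_ofReal hsq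
  have hrle : ∀ p, ∫⁻ x in U, ‖r p x‖ₑ ^ 2 ≤
      ENNReal.ofReal (h ^ 2) ^ 2 * ∫⁻ x in U, D x ^ 2 := by
    intro p
    -- The open triangle is star-shaped about each vertex in the sense required, although the vertex
    -- is not one of its points.
    have hseg := setLIntegral_sq_segment_le isOpen_interior
      (fun x hx t ht => segment_mem_interior hx (hvert p) ht) hDm
    refine le_trans ?_ (mul_le_mul_right hseg _)
    rw [← lintegral_const_mul' _ _ (ENNReal.pow_ne_top ENNReal.ofReal_ne_top)]
    refine setLIntegral_mono' isOpen_interior.measurableSet fun x hx => ?_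
    rw [← mul_pow]
    refine pow_le_pow_left' ?_ 2
    refine hA.enorm_taylor_segment_le hS (hUS hx) (convexHull_subset_closure hK (hvert p))
      (fun t ht => ?_) (dist_le hT hK (hvert p) (interior_subset hx))
    exact interior_mono (convexHull_subset_closure hK) (segment_mem_interior hx (hvert p) ht)
  calc _ ≤ ∫⁻ x in U, ∑ p : K, ‖r p x‖ₑ ^ 2 :=
        setLIntegral_mono' isOpen_interior.measurableSet hpt
    _ = ∑ p : K, ∫⁻ x in U, ‖r p x‖ₑ ^ 2 :=
        lintegral_finsetSum' _ fun p _ =>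
          ((hrc p).enorm.aemeasurable isOpen_interior.measurableSet).pow_const 2
    _ ≤ ∑ _p : K, ENNReal.ofReal (h ^ 2) ^ 2 * ∫⁻ x in U, D x ^ 2 :=
        Finset.sum_le_sum fun p _ => hrle p
    _ = _ := by
        rw [Finset.sum_const, Finset.card_univ, Fintype.card_coe, hK.2, nsmul_eq_mul, mul_assoc]
        norm_num [hD]

/-- The `L²` error of `P1` interpolation on an arbitrary conforming mesh. -/
lemma eLpNorm_interpolation_le (hΩ : IsOpen Ω) (hreg : interior (closure Ω) = Ω) {h : ℝ}
    (hT : T.WidthLE h) {A : Plane → ℂ} (hA : ContDiffOn ℝ 2 A (closure Ω)) :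
    eLpNorm (fun x => A x - T.glue (fun p _ => A p) x) 2 (volume.restrict Ω) ≤
      2 * (ENNReal.ofReal (h ^ 2) * seminormH2 Ω A) := by
  rw [seminormH2, eLpNorm_congr_ae (ae_iteratedFDeriv_eq_within_closure hΩ A)]
  refine (ENNReal.pow_right_strictMono two_ne_zero).le_iff_le.1 ?_
  rw [mul_pow, mul_pow, eLpNorm_two_sq, eLpNorm_two_sq]
  calc _ ≤ ∑ K ∈ T.finite_triangles.toFinset, ∫⁻ x in interior (convexHull ℝ (K : Set Plane)),
          ‖A x - T.glue (fun p _ => A p) x‖ₑ ^ 2 := T.lintegral_le_sum_triangles _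
    _ ≤ ∑ K ∈ T.finite_triangles.toFinset, 3 * ENNReal.ofReal (h ^ 2) ^ 2 *
          ∫⁻ x in interior (convexHull ℝ (K : Set Plane)),
            ‖iteratedFDerivWithin ℝ 2 A (closure Ω) x‖ₑ ^ 2 :=
        Finset.sum_le_sum fun K hK => setLIntegral_interpolation_sq_le hT hA
          (T.finite_triangles.mem_toFinset.1 hK)
    _ ≤ 3 * ENNReal.ofReal (h ^ 2) ^ 2 *
          ∫⁻ x in Ω, ‖iteratedFDerivWithin ℝ 2 A (closure Ω) x‖ₑ ^ 2 := by
        rw [← Finset.mul_sum]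
        exact mul_le_mul_right (T.sum_triangles_le_lintegral hreg _) _
    _ ≤ _ := by
        rw [mul_assoc]
        -- The factor 3 counts the vertices; `3 ≤ 2²` gives the constant 2 after taking roots.
        exact mul_le_mul_left (by norm_num) _

end TriangularMesh

/-! ### Phase error of the plane waves. -/

namespace IsSingleWaveFront

variable {Ω : Set Plane} {A : Plane → ℂ} {φ c : Plane → ℝ}

/-- No continuity of `c` is assumed; the eikonal equation identifies `1 / c` with the continuous
function `|∇φ|`. -/
lemma continuousOn_inv_speed (hF : IsSingleWaveFront Ω A φ c) (hS : UniqueDiffOn ℝ (closure Ω)) :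
    ContinuousOn (fun x => (c x)⁻¹) (closure Ω) := by
  have h : ContinuousOn (fun x => ‖gradientWithin φ (closure Ω) x‖) (closure Ω) := by
    have h1 := hF.phase.continuousOn_fderivWithin hS (by norm_num)
    exact ((LinearIsometryEquiv.continuous _).comp_continuousOn h1).norm
  exact h.congr fun x hx => by simp only [hF.eikonal x hx, one_div]

/-- This is where the eikonal equation makes a plane wave with wave number `ω / c` and exact
direction match the phase `ωφ` to first order. -/
lemma speed_smul_rayDirection (hF : IsSingleWaveFront Ω A φ c) {x : Plane} (hx : x ∈ closure Ω) :
    (c x)⁻¹ • rayDirection Ω φ x = gradientWithin φ (closure Ω) x := by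
  have hc := hF.speed_pos x hx
  rw [rayDirection, hF.eikonal x hx, smul_smul]
  simp [hc.ne']

/-- The phase error of the plane wave attached to a vertex of a triangle. -/
lemma phase_error_le (hF : IsSingleWaveFront Ω A φ c) {T : TriangularMesh Ω}
    {h ω δ M N : ℝ} (hω : 0 < ω) (hT : T.WidthLE h)
    (hM : ∀ x ∈ closure Ω, ‖iteratedFDerivWithin ℝ 2 φ (closure Ω) x‖ ≤ M)
    (hN : ∀ x ∈ closure Ω, (c x)⁻¹ ≤ N) {K : Finset Plane} (hK : K ∈ T.triangles)
    {x p d : Plane} (hx : x ∈ interior (convexHull ℝ (K : Set Plane))) (hp : p ∈ K)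
    (hd : ‖rayDirection Ω φ p - d‖ ≤ δ) :
    |ω * φ x - (ω * φ p + ω / c p * inner ℝ d (x - p))| ≤ ω * h ^ 2 * M + ω * N * δ * h := by
  have hS := T.uniqueDiffOn_closure
  have hpK : p ∈ convexHull ℝ (K : Set Plane) := subset_convexHull ℝ _ hp
  have hpS := TriangularMesh.convexHull_subset_closure hK hpK
  have hxK := interior_subset hx
  have hxS := TriangularMesh.convexHull_subset_closure hK hxK
  have hdist := TriangularMesh.dist_le hT hK hxK hpK
  have hh : 0 ≤ h := (norm_nonneg _).trans hdist
  -- The expansion is now about the vertex `p`, which may lie on the boundary. Reversing the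
  -- segment, so that it starts at the interior point `x`, keeps its relative interior inside.
  have hseg : ∀ t ∈ Set.Ioo (0 : ℝ) 1, p + t • (x - p) ∈ interior (closure Ω) := by
    intro t ht
    have ht' : 1 - t ∈ Set.Ioo (0 : ℝ) 1 := ⟨by linarith [ht.2], by linarith [ht.1]⟩
    have h1 := TriangularMesh.segment_mem_interior hx hpK ht'
    have h2 : x + (1 - t) • (p - x) = p + t • (x - p) := by module
    exact interior_mono (TriangularMesh.convexHull_subset_closure hK) (h2 ▸ h1)
  have hM0 : 0 ≤ M := (norm_nonneg _).trans (hM x hxS)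
  have htaylor : |φ x - φ p - inner ℝ (gradientWithin φ (closure Ω) p) (x - p)| ≤ h ^ 2 * M := by
    have h1 : inner ℝ (gradientWithin φ (closure Ω) p) (x - p) =
        fderivWithin ℝ φ (closure Ω) p (x - p) := by
      rw [gradientWithin, InnerProductSpace.toDual_symm_apply]
    rw [h1, hF.phase.taylor_segment hS hpS hxS hseg, ← Real.norm_eq_abs]
    refine (intervalIntegral.norm_integral_le_of_norm_le_const (C := h ^ 2 * M) ?_).trans (by simp)
    intro t ht
    rw [Set.uIoc_of_le zero_le_one] at ht
    have hmem : p + t • (x - p) ∈ closure Ω := by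
      rcases eq_or_lt_of_le ht.2 with h1 | h1
      · simpa [h1] using hxS
      · exact interior_subset (hseg t ⟨ht.1, h1⟩)
    rw [norm_smul]
    have h2 : ‖iteratedFDerivWithin ℝ 2 φ (closure Ω) (p + t • (x - p)) ![x - p, x - p]‖ ≤
        h ^ 2 * M := by
      refine (ContinuousMultilinearMap.le_opNorm _ _).trans ?_
      rw [mul_comm]
      simp only [Fin.prod_univ_two, Matrix.cons_val_zero, Matrix.cons_val_one, ← sq]
      gcongr
      exact hM _ hmem
    have h3 : ‖1 - t‖ ≤ 1 := by
      rw [Real.norm_eq_abs, abs_le]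
      constructor <;> linarith [ht.1, ht.2]
    calc _ ≤ 1 * (h ^ 2 * M) := by gcongr
      _ = _ := one_mul _
  have hc := hF.speed_pos p hpS
  have hangle : |(c p)⁻¹ * inner ℝ (rayDirection Ω φ p - d) (x - p)| ≤ N * δ * h := by
    rw [abs_mul, abs_of_pos (inv_pos.2 hc), mul_assoc]
    have hN0 : 0 ≤ N := (inv_pos.2 hc).le.trans (hN p hpS)
    have hδ : 0 ≤ δ := (norm_nonneg _).trans hd
    have := abs_real_inner_le_norm (rayDirection Ω φ p - d) (x - p)
    calc _ ≤ N * (‖rayDirection Ω φ p - d‖ * ‖x - p‖) := by gcongr; exact hN p hpS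
      _ ≤ N * (δ * h) := by gcongr
  -- Adding and subtracting the exact ray direction separates curvature of the front from the error
  -- in the estimated direction.
  have hsplit : ω * φ x - (ω * φ p + ω / c p * inner ℝ d (x - p)) =
      ω * ((φ x - φ p - inner ℝ (gradientWithin φ (closure Ω) p) (x - p)) +
        (c p)⁻¹ * inner ℝ (rayDirection Ω φ p - d) (x - p)) := by
    rw [← hF.speed_smul_rayDirection hpS, inner_sub_left, real_inner_smul_left]
    ring
  rw [hsplit, abs_mul, abs_of_pos hω]
  calc _ ≤ ω * (h ^ 2 * M + N * δ * h) := by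
        gcongr
        exact (abs_add_le _ _).trans (add_le_add htaylor hangle)
    _ = _ := by ring

end IsSingleWaveFront

/-! ### The ray interpolant and the error bounds. -/

namespace IsSingleWaveFront

variable {Ω : Set Plane} {A : Plane → ℂ} {φ c : Plane → ℝ}

/-- The nodal coefficients of the ray-FEM interpolant of `A exp (i ω φ)`. -/
noncomputable def rayCoefficient (A : Plane → ℂ) (φ c : Plane → ℝ) (ω : ℝ) (d : Plane → Plane)
    (p : Plane) : ℂ :=
  A p * Complex.exp (Complex.I * ((ω * φ p - ω / c p * inner ℝ (d p) p : ℝ) : ℂ))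

/-- On an open triangle, replacing the oscillating factor `exp (i ω φ)` by the plane waves attached
to the vertices costs at most the phase error times the size of the amplitude. -/
lemma norm_exp_mul_glue_sub_le (hF : IsSingleWaveFront Ω A φ c) (T : TriangularMesh Ω)
    {h ω C₁ M N L : ℝ} (hω : 0 < ω) (hT : T.WidthLE h) {d : Plane → Plane}
    (hd : DirectionsWithin T φ C₁ ω d)
    (hM : ∀ x ∈ closure Ω, ‖iteratedFDerivWithin ℝ 2 φ (closure Ω) x‖ ≤ M)
    (hN : ∀ x ∈ closure Ω, (c x)⁻¹ ≤ N) (hL : ∀ x ∈ closure Ω, ‖A x‖ ≤ L)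
    {K : Finset Plane} (hK : K ∈ T.triangles)
    {x : Plane} (hx : x ∈ interior (convexHull ℝ (K : Set Plane))) :
    ‖Complex.exp (Complex.I * ((ω * φ x : ℝ) : ℂ)) * T.glue (fun p _ => A p) x -
        T.glue (fun p x => rayCoefficient A φ c ω d p * planeWave (ω / c p) (d p) x) x‖ ≤
      ω * h ^ 2 * L * M + C₁ * (ω ^ (1 / 2 : ℝ) * h) * L * N := by
  have hxK := interior_subset hx
  rw [T.glue_eq _ hK hxK, T.glue_eq _ hK hxK, Finset.mul_sum, ← Finset.sum_sub_distrib]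
  set B := ω * h ^ 2 * M + ω * N * (C₁ * ω ^ (-(1 / 2) : ℝ)) * h with hB
  have hpow : ω * ω ^ (-(1 / 2) : ℝ) = ω ^ (1 / 2 : ℝ) := by
    nth_rewrite 1 [← Real.rpow_one ω]
    rw [← Real.rpow_add hω]
    norm_num
  have hterm : ∀ p : K, ‖Complex.exp (Complex.I * ((ω * φ x : ℝ) : ℂ)) *
      (((shapeFunction K (T.complex.indep hK.1) hK.2 p x : ℝ) : ℂ) * A p) -
      ((shapeFunction K (T.complex.indep hK.1) hK.2 p x : ℝ) : ℂ) *
        (rayCoefficient A φ c ω d p * planeWave (ω / c p) (d p) x)‖ ≤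
      shapeFunction K (T.complex.indep hK.1) hK.2 p x * (L * B) := by
    intro p
    have hpS := TriangularMesh.convexHull_subset_closure hK (subset_convexHull ℝ _ p.2)
    -- The term `-(ω / c p) d_p·p` in the coefficient recentres the plane wave at its node.
    have hwave : rayCoefficient A φ c ω d p * planeWave (ω / c p) (d p) x =
        A p * Complex.exp (Complex.I *
          ((ω * φ p + ω / c p * inner ℝ (d p) (x - p) : ℝ) : ℂ)) := by
      rw [rayCoefficient, planeWave, mul_assoc, ← Complex.exp_add, ← mul_add, ← Complex.ofReal_add,
        inner_sub_right]
      congr 4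
      ring
    rw [hwave, show ∀ e s a e' : ℂ, e * (s * a) - s * (a * e') = s * (a * (e - e')) by
      intros; ring, norm_mul, norm_mul, Complex.norm_real,
      Real.norm_of_nonneg (shapeFunction_nonneg p hxK)]
    refine mul_le_mul_of_nonneg_left ?_ (shapeFunction_nonneg p hxK)
    refine mul_le_mul (hL p hpS) ?_ (norm_nonneg _) ((norm_nonneg _).trans (hL p hpS))
    exact (norm_exp_I_mul_sub_le _ _).trans (hF.phase_error_le hω hT hM hN hK hx p.2
      (hd p (TriangularMesh.mem_nodes hK p.2)))
  calc _ ≤ ∑ p : K, shapeFunction K (T.complex.indep hK.1) hK.2 p x * (L * B) :=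
        (norm_sum_le _ _).trans (Finset.sum_le_sum fun p _ => hterm p)
    _ = L * B := by rw [← Finset.sum_mul, sum_shapeFunction, one_mul]
    _ = _ := by rw [hB, ← hpow]; ring

lemma continuousOn_iteratedFDerivWithin {F : Type*} [NormedAddCommGroup F] [NormedSpace ℝ F]
    {f : Plane → F} {S : Set Plane} (hf : ContDiffOn ℝ 2 f S) (hS : UniqueDiffOn ℝ S) :
    ContinuousOn (iteratedFDerivWithin ℝ 2 f S) S :=
  hf.continuousOn_iteratedFDerivWithin (m := 2) le_rfl hS

lemma normLinf_iteratedFDeriv_eq (hΩ : IsOpen Ω) (f : Plane → ℝ) :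
    normLinf Ω (iteratedFDeriv ℝ 2 f) = normLinf Ω (iteratedFDerivWithin ℝ 2 f (closure Ω)) :=
  eLpNorm_congr_ae (ae_iteratedFDeriv_eq_within_closure hΩ f)

lemma normLinf_ne_top {F : Type} [NormedAddCommGroup F] {f : Plane → F} (hΩ : IsOpen Ω)
    (hb : Bornology.IsBounded Ω) (hf : ContinuousOn f (closure Ω)) : normLinf Ω f ≠ ∞ :=
  eLpNorm_ne_top_of_continuousOn_closure hΩ hb hf ∞

lemma norm_le_toReal_normLinf {F : Type} [NormedAddCommGroup F] {f : Plane → F} (hΩ : IsOpen Ω)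
    (hb : Bornology.IsBounded Ω) (hf : ContinuousOn f (closure Ω)) {x : Plane}
    (hx : x ∈ closure Ω) : ‖f x‖ ≤ (normLinf Ω f).toReal := by
  rw [← toReal_enorm]
  exact ENNReal.toReal_mono (normLinf_ne_top hΩ hb hf)
    (enorm_le_normLinf hΩ hf hx)

/-- The best approximation error of the ray-FEM space, with explicit dependence on the wave front. -/
lemma bestL2Error_le (hΩ : IsOpen Ω) (hb : Bornology.IsBounded Ω)
    (hreg : interior (closure Ω) = Ω) (hF : IsSingleWaveFront Ω A φ c) {C₀ C₁ ω h : ℝ}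
    (hω : 0 < ω) (T : TriangularMesh Ω) {u : Plane → ℂ} {d : Plane → Plane} (hT : T.WidthLE h)
    (hu : GeometricOpticsAnsatz Ω A φ C₀ ω u) (hd : DirectionsWithin T φ C₁ ω d) :
    bestL2Error Ω u (rayFEMSpace T ω c d) ≤
      2 * (ENNReal.ofReal (h ^ 2) * seminormH2 Ω A) +
      volume Ω ^ (1 / 2 : ℝ) *
        (ENNReal.ofReal (ω * h ^ 2) * normLinf Ω A * normLinf Ω (iteratedFDeriv ℝ 2 φ)
          + ENNReal.ofReal (C₁ * (ω ^ (1 / 2 : ℝ) * h)) * normLinf Ω A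
            * normLinf Ω (fun x => (c x)⁻¹))
      + ENNReal.ofReal (C₀ * ω⁻¹) := by
  have hS := T.uniqueDiffOn_closure
  have hAc := hF.amplitude.continuousOn
  have hφc := hF.phase.continuousOn
  have hD2 := continuousOn_iteratedFDerivWithin hF.phase hS
  have hcc := hF.continuousOn_inv_speed hS
  rw [normLinf_iteratedFDeriv_eq hΩ]
  set L := (normLinf Ω A).toReal with hL
  set M := (normLinf Ω (iteratedFDerivWithin ℝ 2 φ (closure Ω))).toReal with hM
  set N := (normLinf Ω (fun x => (c x)⁻¹)).toReal with hN
  set e : Plane → ℂ := fun x => Complex.exp (Complex.I * ((ω * φ x : ℝ) : ℂ)) with he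
  set v₀ := T.glue (fun p _ => A p) with hv₀
  set v := T.glue (fun p x => rayCoefficient A φ c ω d p * planeWave (ω / c p) (d p) x) with hv
  have hec : ContinuousOn e (closure Ω) := by
    have h1 : ContinuousOn (fun x => ((ω * φ x : ℝ) : ℂ)) (closure Ω) :=
      Complex.continuous_ofReal.comp_continuousOn (continuousOn_const.mul hφc)
    exact Complex.continuous_exp.comp_continuousOn (continuousOn_const.mul h1)
  have hv₀c : ContinuousOn v₀ (closure Ω) := T.continuousOn_glue fun _ => continuous_const
  have hvmem : v ∈ rayFEMSpace T ω c d := T.glue_mem_rayFEMSpace _ _ _ _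
  have hvc : ContinuousOn v (closure Ω) := hvmem.1
  have hmeas : ∀ {f : Plane → ℂ}, ContinuousOn f (closure Ω) →
      AEStronglyMeasurable f (volume.restrict Ω) := fun hf =>
    (hf.mono subset_closure).aestronglyMeasurable hΩ.measurableSet
  have h1 : eLpNorm (fun x => u x - A x * e x) 2 (volume.restrict Ω) ≤
      ENNReal.ofReal (C₀ * ω⁻¹) := by
    rw [← div_eq_mul_inv]
    exact hu.2
  have h2 : eLpNorm (fun x => e x * (A x - v₀ x)) 2 (volume.restrict Ω) ≤
      2 * (ENNReal.ofReal (h ^ 2) * seminormH2 Ω A) := by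
    refine le_trans (eLpNorm_mono fun x => ?_)
      (TriangularMesh.eLpNorm_interpolation_le hΩ hreg hT hF.amplitude)
    rw [norm_mul, he, Complex.norm_exp_I_mul_ofReal, one_mul]
  have h3 : eLpNorm (fun x => e x * v₀ x - v x) 2 (volume.restrict Ω) ≤
      volume Ω ^ (1 / 2 : ℝ) *
        (ENNReal.ofReal (ω * h ^ 2) * normLinf Ω A *
            normLinf Ω (iteratedFDerivWithin ℝ 2 φ (closure Ω))
          + ENNReal.ofReal (C₁ * (ω ^ (1 / 2 : ℝ) * h)) * normLinf Ω A
            * normLinf Ω (fun x => (c x)⁻¹)) := by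
    have hae : ∀ᵐ x ∂volume.restrict Ω, ‖e x * v₀ x - v x‖ ≤
        ω * h ^ 2 * L * M + C₁ * (ω ^ (1 / 2 : ℝ) * h) * L * N := by
      filter_upwards [T.ae_mem_interior_triangle hΩ] with x hx
      obtain ⟨K, hK, hxK⟩ := hx
      exact hF.norm_exp_mul_glue_sub_le T hω hT hd
        (fun y hy => norm_le_toReal_normLinf hΩ hb hD2 hy)
        (fun y hy => (le_abs_self _).trans (norm_le_toReal_normLinf hΩ hb hcc hy))
        (fun y hy => norm_le_toReal_normLinf hΩ hb hAc hy) hK hxK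
    refine (eLpNorm_le_of_ae_bound hae).trans ?_
    rw [Measure.restrict_apply_univ]
    simp only [ENNReal.toReal_ofNat, one_div]
    -- The sign of `C₁` is unrestricted, so `ENNReal.ofReal` is only subadditive here, and products
    -- are split using nonnegativity of the right factor alone.
    refine mul_le_mul_right (ENNReal.ofReal_add_le.trans (le_of_eq ?_)) _
    have hL0 : 0 ≤ L := ENNReal.toReal_nonneg
    have hM0 : 0 ≤ M := ENNReal.toReal_nonneg
    have hN0 : 0 ≤ N := ENNReal.toReal_nonneg
    rw [ENNReal.ofReal_mul' hM0, ENNReal.ofReal_mul' hL0, ENNReal.ofReal_mul' hN0,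
      ENNReal.ofReal_mul' hL0, ENNReal.ofReal_toReal (normLinf_ne_top hΩ hb hAc),
      ENNReal.ofReal_toReal (normLinf_ne_top hΩ hb hD2),
      ENNReal.ofReal_toReal (normLinf_ne_top hΩ hb hcc)]
  have hsplit : u - v = (fun x => u x - A x * e x) +
      ((fun x => e x * (A x - v₀ x)) + fun x => e x * v₀ x - v x) := by
    ext x
    simp only [Pi.sub_apply, Pi.add_apply]
    ring
  calc bestL2Error Ω u (rayFEMSpace T ω c d) ≤ eLpNorm (u - v) 2 (volume.restrict Ω) :=
        iInf₂_le v hvmem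
    _ ≤ ENNReal.ofReal (C₀ * ω⁻¹) + (_ + _) := by
        rw [hsplit]
        refine (eLpNorm_add_le (hu.1.1.sub (hmeas (hAc.mul hec)))
          ((hmeas (hec.mul (hAc.sub hv₀c))).add (hmeas ((hec.mul hv₀c).sub hvc)))
          (by norm_num)).trans (add_le_add h1 ?_)
        exact (eLpNorm_add_le (hmeas (hec.mul (hAc.sub hv₀c))) (hmeas ((hec.mul hv₀c).sub hvc))
          (by norm_num)).trans (add_le_add h2 h3)
    _ = _ := add_comm _ _

/-- The best approximation error of the ray-FEM space, with a constant depending on `Ω` only. -/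
lemma exists_bestL2Error_le (hΩ : IsOpen Ω) (hb : Bornology.IsBounded Ω)
    (hreg : interior (closure Ω) = Ω) :
    ∃ C : ℝ≥0, ∀ (A : Plane → ℂ) (φ c : Plane → ℝ), IsSingleWaveFront Ω A φ c →
      ∀ C₀ C₁ ω h : ℝ, 0 < ω → 0 < h →
      ∀ (T : TriangularMesh Ω) (u : Plane → ℂ) (d : Plane → Plane),
        T.WidthLE h → GeometricOpticsAnsatz Ω A φ C₀ ω u → DirectionsWithin T φ C₁ ω d →
        bestL2Error Ω u (rayFEMSpace T ω c d) ≤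
          C * (ENNReal.ofReal (h ^ 2) * seminormH2 Ω A
            + ENNReal.ofReal (ω * h ^ 2) * normLinf Ω A * normLinf Ω (iteratedFDeriv ℝ 2 φ)
            + ENNReal.ofReal (C₁ * (ω ^ (1 / 2 : ℝ) * h)) * normLinf Ω A
                * normLinf Ω (fun x => (c x)⁻¹)
            + ENNReal.ofReal (C₀ * ω⁻¹)) := by
  have hV : volume Ω ^ (1 / 2 : ℝ) ≠ ∞ :=
    ENNReal.rpow_ne_top_of_nonneg (by norm_num) hb.measure_lt_top.ne
  -- The 2 is the interpolation constant and `|Ω|^{1/2}` the price of passing from a sup bound to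
  -- `L²`; their sum dominates both, and also the factor 1 of the ansatz term.
  refine ⟨2 + (volume Ω ^ (1 / 2 : ℝ)).toNNReal, ?_⟩
  intro A φ c hF C₀ C₁ ω h hω _ T u d hT hu hd
  refine (hF.bestL2Error_le hΩ hb hreg hω T hT hu hd).trans ?_
  push_cast
  rw [ENNReal.coe_toNNReal hV]
  set V := volume Ω ^ (1 / 2 : ℝ)
  rw [add_assoc (ENNReal.ofReal (h ^ 2) * seminormH2 Ω A), mul_add (2 + V),
    mul_add (2 + V)]
  refine add_le_add (add_le_add ?_ ?_) ?_
  · exact mul_le_mul_left le_self_add _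
  · exact mul_le_mul_left le_add_self _
  · exact le_mul_of_one_le_left' ((by norm_num : (1 : ℝ≥0∞) ≤ 2).trans le_self_add)

/-- For a fixed wave front the best approximation error is bounded uniformly in the frequency, the
mesh, the wave field and the estimated directions. -/
lemma exists_bestL2Error_le_ofReal (hΩ : IsOpen Ω) (hb : Bornology.IsBounded Ω)
    (hreg : interior (closure Ω) = Ω) (hF : IsSingleWaveFront Ω A φ c) (C₀ C₁ : ℝ) :
    ∃ C : ℝ, 0 ≤ C ∧ ∀ ω h : ℝ, 0 < ω → 0 < h →
      ∀ (T : TriangularMesh Ω) (u : Plane → ℂ) (d : Plane → Plane),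
        T.WidthLE h → GeometricOpticsAnsatz Ω A φ C₀ ω u → DirectionsWithin T φ C₁ ω d →
        bestL2Error Ω u (rayFEMSpace T ω c d) ≤
          ENNReal.ofReal (C * (h ^ 2 + ω * h ^ 2 + ω ^ (1 / 2 : ℝ) * h + ω⁻¹)) := by
  -- Finiteness of the norms uses unique differentiability on `closure Ω`, which comes from a mesh;
  -- if there is none, the claim is vacuous.
  by_cases hmesh : Nonempty (TriangularMesh Ω)
  swap
  · exact ⟨0, le_rfl, fun _ _ _ _ T => (hmesh ⟨T⟩).elim⟩
  obtain ⟨T₀⟩ := hmesh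
  have hS := T₀.uniqueDiffOn_closure
  obtain ⟨C, hC⟩ := exists_bestL2Error_le hΩ hb hreg
  have hAtop : normLinf Ω A ≠ ∞ :=
    normLinf_ne_top hΩ hb hF.amplitude.continuousOn
  have hφtop : normLinf Ω (iteratedFDeriv ℝ 2 φ) ≠ ∞ := by
    rw [normLinf_iteratedFDeriv_eq hΩ]
    exact normLinf_ne_top hΩ hb (continuousOn_iteratedFDerivWithin hF.phase hS)
  have hctop : normLinf Ω (fun x => (c x)⁻¹) ≠ ∞ :=
    normLinf_ne_top hΩ hb (hF.continuousOn_inv_speed hS)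
  have hH2top : seminormH2 Ω A ≠ ∞ := by
    rw [seminormH2, eLpNorm_congr_ae (ae_iteratedFDeriv_eq_within_closure hΩ A)]
    exact eLpNorm_ne_top_of_continuousOn_closure hΩ hb
      (continuousOn_iteratedFDerivWithin hF.amplitude hS) 2
  set X := (seminormH2 Ω A).toReal with hX
  set Y := (normLinf Ω A).toReal * (normLinf Ω (iteratedFDeriv ℝ 2 φ)).toReal with hY
  set Z := (normLinf Ω A).toReal * (normLinf Ω (fun x => (c x)⁻¹)).toReal with hZ
  have hX0 : 0 ≤ X := ENNReal.toReal_nonneg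
  have hY0 : 0 ≤ Y := mul_nonneg ENNReal.toReal_nonneg ENNReal.toReal_nonneg
  have hZ0 : 0 ≤ Z := mul_nonneg ENNReal.toReal_nonneg ENNReal.toReal_nonneg
  have hXe : seminormH2 Ω A = ENNReal.ofReal X := (ENNReal.ofReal_toReal hH2top).symm
  have hYe : normLinf Ω A * normLinf Ω (iteratedFDeriv ℝ 2 φ) = ENNReal.ofReal Y := by
    rw [hY, ENNReal.ofReal_mul ENNReal.toReal_nonneg, ENNReal.ofReal_toReal hAtop,
      ENNReal.ofReal_toReal hφtop]
  have hZe : normLinf Ω A * normLinf Ω (fun x => (c x)⁻¹) = ENNReal.ofReal Z := by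
    rw [hZ, ENNReal.ofReal_mul ENNReal.toReal_nonneg, ENNReal.ofReal_toReal hAtop,
      ENNReal.ofReal_toReal hctop]
  -- Absolute values make the constant nonnegative whatever the signs of `C₀` and `C₁`, so that it
  -- can later multiply an inequality.
  refine ⟨C * (X + Y + |C₁| * Z + |C₀|), by positivity, ?_⟩
  intro ω h hω hh T u d hT hu hd
  refine (hC A φ c hF C₀ C₁ ω h hω hh T u d hT hu hd).trans ?_
  rw [mul_assoc (ENNReal.ofReal (ω * h ^ 2)), mul_assoc (ENNReal.ofReal (C₁ * _)), hXe, hYe, hZe,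
    ← ENNReal.ofReal_mul' hX0, ← ENNReal.ofReal_mul' hY0, ← ENNReal.ofReal_mul' hZ0]
  set s := ω ^ (1 / 2 : ℝ) * h with hs
  have hs0 : 0 ≤ s := by positivity
  have hC₁ : C₁ * s * Z ≤ |C₁| * s * Z := by gcongr; exact le_abs_self _
  have hC₀ : C₀ * ω⁻¹ ≤ |C₀| * ω⁻¹ := by gcongr; exact le_abs_self _
  calc _ ≤ (C : ℝ≥0∞) * (ENNReal.ofReal (h ^ 2 * X) + ENNReal.ofReal (ω * h ^ 2 * Y)
        + ENNReal.ofReal (|C₁| * s * Z) + ENNReal.ofReal (|C₀| * ω⁻¹)) := by gcongr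
    _ = ENNReal.ofReal (C * (h ^ 2 * X + ω * h ^ 2 * Y + |C₁| * s * Z + |C₀| * ω⁻¹)) := by
        rw [ENNReal.ofReal_mul C.coe_nonneg, ENNReal.ofReal_coe_nnreal, ENNReal.ofReal_add,
          ENNReal.ofReal_add, ENNReal.ofReal_add] <;> positivity
    _ ≤ _ := by
        apply ENNReal.ofReal_le_ofReal
        rw [mul_assoc (C : ℝ)]
        refine mul_le_mul_of_nonneg_left ?_ C.coe_nonneg
        set Q := h ^ 2 + ω * h ^ 2 + s + ω⁻¹ with hQ
        have i0 : 0 ≤ ω⁻¹ := by positivity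
        have i1 : 0 ≤ ω * h ^ 2 := by positivity
        have h1 : h ^ 2 ≤ Q := by rw [hQ]; nlinarith [sq_nonneg h]
        have h2 : ω * h ^ 2 ≤ Q := by rw [hQ]; nlinarith [sq_nonneg h]
        have h3 : s ≤ Q := by rw [hQ]; nlinarith [sq_nonneg h]
        have h4 : ω⁻¹ ≤ Q := by rw [hQ]; nlinarith [sq_nonneg h]
        calc _ ≤ Q * X + Q * Y + |C₁| * Q * Z + |C₀| * Q := by gcongr
          _ = _ := by ring

/-- In the regime `ω h ≤ κ`, the four error terms are all of order `ω^{-1/2}`. -/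
lemma error_terms_le {κ ω₀ ω h : ℝ} (hω₀ : 0 < ω₀) (hω : ω₀ ≤ ω) (hh : 0 < h) (hκ : ω * h ≤ κ) :
    h ^ 2 + ω * h ^ 2 + ω ^ (1 / 2 : ℝ) * h + ω⁻¹ ≤
      ((κ ^ 2 * ω₀⁻¹ + κ ^ 2 + 1) * ω₀ ^ (-(1 / 2) : ℝ) + κ) * ω ^ (-(1 / 2) : ℝ) := by
  have hpos : 0 < ω := hω₀.trans_le hω
  set r := ω ^ (-(1 / 2) : ℝ) with hr
  have hr0 : 0 < r := Real.rpow_pos_of_pos hpos _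
  set q := ω₀ ^ (-(1 / 2) : ℝ) with hq
  -- Only `ω^{1/2} h = (ωh) ω^{-1/2}` is genuinely of order `ω^{-1/2}`. The other terms are
  -- `O(ω^{-1})`, and this bound trades their surplus `ω^{-1/2}` for `ω₀^{-1/2}`.
  have hrq : r ≤ q := Real.rpow_le_rpow_of_nonpos hω₀ hω (by norm_num)
  have hrr : r * r = ω⁻¹ := by
    rw [hr, ← Real.rpow_add hpos, ← Real.rpow_neg_one]
    norm_num
  have hhalf : ω ^ (1 / 2 : ℝ) = ω * r := by
    nth_rewrite 2 [← Real.rpow_one ω]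
    rw [hr, ← Real.rpow_add hpos]
    norm_num
  have hinv : ω⁻¹ ≤ ω₀⁻¹ := by gcongr
  have hinvr : ω⁻¹ ≤ q * r := by rw [← hrr]; gcongr
  have hh' : h ≤ κ * ω⁻¹ := by
    rw [← div_eq_mul_inv, le_div_iff₀ hpos]
    linarith
  have hκ0 : 0 < κ := (mul_pos hpos hh).trans_le hκ
  have t2 : ω * h ^ 2 ≤ κ ^ 2 * (q * r) := by
    calc ω * h ^ 2 = (ω * h) * h := by ring
      _ ≤ κ * (κ * ω⁻¹) := by gcongr
      _ = κ ^ 2 * ω⁻¹ := by ring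
      _ ≤ _ := by gcongr
  have t1 : h ^ 2 ≤ κ ^ 2 * ω₀⁻¹ * (q * r) := by
    calc h ^ 2 = ω⁻¹ * (ω * h ^ 2) := by field_simp
      _ ≤ ω₀⁻¹ * (κ ^ 2 * (q * r)) := by gcongr
      _ = _ := by ring
  have t3 : ω ^ (1 / 2 : ℝ) * h ≤ κ * r := by
    calc ω ^ (1 / 2 : ℝ) * h = (ω * h) * r := by rw [hhalf]; ring
      _ ≤ _ := by gcongr
  calc _ ≤ κ ^ 2 * ω₀⁻¹ * (q * r) + κ ^ 2 * (q * r) + κ * r + q * r := by gcongr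
    _ = _ := by ring

end IsSingleWaveFront

theorem mainTheorem2 (Ω : Set Plane) (hΩ_open : IsOpen Ω) (hΩ_bdd : Bornology.IsBounded Ω)
    (hΩ_reg : interior (closure Ω) = Ω) :
    -- the bound with explicit norms; the constant depends on `Ω` only
    (∃ C : ℝ≥0, ∀ (A : Plane → ℂ) (φ c : Plane → ℝ), IsSingleWaveFront Ω A φ c →
      ∀ C₀ C₁ ω h : ℝ, 0 < ω → 0 < h →
      ∀ (T : TriangularMesh Ω) (u : Plane → ℂ) (d : Plane → Plane),
        T.WidthLE h → GeometricOpticsAnsatz Ω A φ C₀ ω u → DirectionsWithin T φ C₁ ω d →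
        bestL2Error Ω u (rayFEMSpace T ω c d) ≤
          C * (ENNReal.ofReal (h ^ 2) * seminormH2 Ω A
            + ENNReal.ofReal (ω * h ^ 2) * normLinf Ω A * normLinf Ω (iteratedFDeriv ℝ 2 φ)
            + ENNReal.ofReal (C₁ * (ω ^ (1 / 2 : ℝ) * h)) * normLinf Ω A
                * normLinf Ω (fun x => (c x)⁻¹)
            + ENNReal.ofReal (C₀ * ω⁻¹))) ∧
    -- the asymptotic bound, uniform in frequency, mesh, wave field and estimated directions
    (∀ (A : Plane → ℂ) (φ c : Plane → ℝ), IsSingleWaveFront Ω A φ c → ∀ C₀ C₁ : ℝ,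
      ∃ C : ℝ, ∀ ω h : ℝ, 0 < ω → 0 < h →
      ∀ (T : TriangularMesh Ω) (u : Plane → ℂ) (d : Plane → Plane),
        T.WidthLE h → GeometricOpticsAnsatz Ω A φ C₀ ω u → DirectionsWithin T φ C₁ ω d →
        bestL2Error Ω u (rayFEMSpace T ω c d) ≤
          ENNReal.ofReal (C * (h ^ 2 + ω * h ^ 2 + ω ^ (1 / 2 : ℝ) * h + ω⁻¹))) ∧
    -- the rate `ω^{-1/2}` in the regime `ω h ≤ κ`, for frequencies bounded away from zero
    (∀ (A : Plane → ℂ) (φ c : Plane → ℝ), IsSingleWaveFront Ω A φ c → ∀ C₀ C₁ κ ω₀ : ℝ, 0 < ω₀ →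
      ∃ C : ℝ, ∀ ω h : ℝ, ω₀ ≤ ω → 0 < h → ω * h ≤ κ →
      ∀ (T : TriangularMesh Ω) (u : Plane → ℂ) (d : Plane → Plane),
        T.WidthLE h → GeometricOpticsAnsatz Ω A φ C₀ ω u → DirectionsWithin T φ C₁ ω d →
        bestL2Error Ω u (rayFEMSpace T ω c d) ≤
          ENNReal.ofReal (C * ω ^ (-(1 / 2) : ℝ))) := by
  refine ⟨IsSingleWaveFront.exists_bestL2Error_le hΩ_open hΩ_bdd hΩ_reg, ?_, ?_⟩
  · intro A φ c hF C₀ C₁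
    obtain ⟨C, -, hC⟩ := hF.exists_bestL2Error_le_ofReal hΩ_open hΩ_bdd hΩ_reg C₀ C₁
    exact ⟨C, hC⟩
  · intro A φ c hF C₀ C₁ κ ω₀ hω₀
    obtain ⟨C, hC0, hC⟩ := hF.exists_bestL2Error_le_ofReal hΩ_open hΩ_bdd hΩ_reg C₀ C₁
    refine ⟨C * ((κ ^ 2 * ω₀⁻¹ + κ ^ 2 + 1) * ω₀ ^ (-(1 / 2) : ℝ) + κ), ?_⟩
    intro ω h hω hh hκ T u d hT hu hd
    refine (hC ω h (hω₀.trans_le hω) hh T u d hT hu hd).trans (ENNReal.ofReal_le_ofReal ?_)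
    rw [mul_assoc C]
    exact mul_le_mul_of_nonneg_left (IsSingleWaveFront.error_terms_le hω₀ hω hh hκ) hC0
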